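/- Let $K$ be a field of characteristic $0$. A \emph{word} is a finite (possibly empty) sequence of positive integers (its letters); $u\cdot v$ denotes concatenation, $\max(u)$ the largest letter of $u$ (with $\max(\emptyset)=0$), and $u[k]$ the word obtained from $u$ by replacing each letter $i$ by $i+k$. If $b_1<\dots<b_r$ are the letters occurring in a word $w$, then $\mathrm{pack}(w)$ is obtained from $w$ by replacing each $b_i$ by $i$; a word $u$ is \emph{packed} if $\mathrm{pack}(u)=u$. For a packed word $u$ let $$M_u=\sum_{\mathrm{pack}(w)=u} w,$$ a formal series in noncommuting variables $a_1,a_2,\dots$ (a word $w$ being identified with the corresponding monomial). The $M_u$ span over $K$ an algebra $\mathbf{WQSym}$ for the concatenation product. For a packed word $u=u_1\cdots u_n$ and $1\le i<j\le n$, let the value of the inversion $(i,j)$ of $u$ be $1$ if $u_i>u_j$, $\tfrac12$ if $u_i=u_j$, and $0$ if $u_i<u_j$. In the pseudo-permutohedron order, $u\preceq v$ means that the packed words $u$ and $v$ have the same length and that, for all $i<j$, the value of $(i,j)$ in $u$ is at most its value in $v$. Put $$S_u=\sum_{v\preceq u}M_v,\qquad E_u=\sum_{u\preceq v}M_v .$$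 \textbf{Theorem.} The families $(S_u)$ and $(E_u)$, where $u$ runs over all packed words, are bases of the $K$-vector space $\mathbf{WQSym}$. Moreover, for all packed words $u'$ and $u''$, $$S_{u'}S_{u''}=S_{u'[\max(u'')]\cdot u''},\qquad E_{u'}E_{u''}=E_{u'\cdot u''[\max(u')]} .$$ -/

import Mathlib

noncomputable section

/-! ### Words and packed words

The alphabet is the set of positive integers; a word is a list of letters. -/

namespace WQ

/-- The position of the letter `b` among the distinct letters of `w`, counted from `1`
(for `b` a letter of `w`). -/
def rank (w : List ℕ+) (b : ℕ+) : ℕ+ :=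
  Nat.succPNat (w.toFinset.filter (fun c => c < b)).card

/-- The packed word of `w`: if `b₁ < ... < b_r` are the letters occurring in `w`,
each `b_i` is replaced by `i`. -/
def pack (w : List ℕ+) : List ℕ+ := w.map (rank w)

/-- The largest letter of a word, `0` for the empty word. -/
def maxLetter (w : List ℕ+) : ℕ := w.toFinset.sup (fun a => (a : ℕ))

/-- The letter `a + k`. -/
def shiftLetter (k : ℕ) (a : ℕ+) : ℕ+ := ⟨(a : ℕ) + k, Nat.add_pos_left a.pos k⟩

theorem shiftLetter_coe (k : ℕ) (a : ℕ+) : (shiftLetter k a : ℕ) = (a : ℕ) + k := rfl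

/-- The word `w[k]`, in which each letter `i` is replaced by `i + k`. -/
def shift (w : List ℕ+) (k : ℕ) : List ℕ+ :=
  w.map (shiftLetter k)

theorem rank_strictMonoOn (w : List ℕ+) : StrictMonoOn (rank w) {a | a ∈ w} := by
  intro a ha b _ hab
  unfold rank
  rw [Nat.succPNat_lt_succPNat]
  apply Finset.card_lt_card
  rw [Finset.ssubset_iff_of_subset]
  · exact ⟨a, by simpa using ⟨ha, hab⟩, by simp⟩
  · intro c hc
    simp only [Finset.mem_filter] at hc ⊢
    exact ⟨hc.1, hc.2.trans hab⟩

theorem pack_map (w : List ℕ+) (f : ℕ+ → ℕ+) (hf : StrictMonoOn f {a | a ∈ w}) :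
    pack (w.map f) = pack w := by
  unfold pack
  rw [List.map_map]
  apply List.map_congr_left
  intro b hb
  simp only [Function.comp, rank]
  congr 1
  have h : (w.map f).toFinset.filter (fun c => c < f b)
      = (w.toFinset.filter (fun c => c < b)).image f := by
    ext c
    simp only [Finset.mem_filter, List.mem_toFinset, List.mem_map, Finset.mem_image]
    constructor
    · rintro ⟨⟨a, ha, rfl⟩, h⟩
      exact ⟨a, ⟨ha, (hf.lt_iff_lt ha hb).1 h⟩, rfl⟩
    · rintro ⟨a, ⟨ha, h⟩, rfl⟩
      exact ⟨⟨a, ha, rfl⟩, hf ha hb h⟩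
  rw [h, Finset.card_image_of_injOn]
  intro x hx y hy hxy
  simp only [Finset.coe_filter, List.mem_toFinset, Set.mem_ofPred_eq] at hx hy
  exact hf.injOn hx.1 hy.1 hxy

theorem pack_pack (w : List ℕ+) : pack (pack w) = pack w :=
  pack_map w (rank w) (rank_strictMonoOn w)

theorem length_pack (w : List ℕ+) : (pack w).length = w.length := by simp [pack]

theorem pack_take (w : List ℕ+) (i : ℕ) : pack ((pack w).take i) = pack (w.take i) := by
  have h : (pack w).take i = (w.take i).map (rank w) := by rw [pack, List.map_take]
  rw [h]
  exact pack_map _ _ ((rank_strictMonoOn w).mono fun _ h => List.mem_of_mem_take h)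

theorem pack_drop (w : List ℕ+) (i : ℕ) : pack ((pack w).drop i) = pack (w.drop i) := by
  have h : (pack w).drop i = (w.drop i).map (rank w) := by rw [pack, List.map_drop]
  rw [h]
  exact pack_map _ _ ((rank_strictMonoOn w).mono fun _ h => List.mem_of_mem_drop h)

theorem packed_iff (w : List ℕ+) : pack w = w ↔ ∀ a ∈ w, ∀ b, b < a → b ∈ w := by
  have key : pack w = w ↔ ∀ a ∈ w, rank w a = a := by
    constructor
    · intro h
      have h' : w.map (rank w) = w.map id := by rw [List.map_id]; exact h
      exact List.map_inj_left.1 h'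
    · intro h
      exact (List.map_congr_left (g := id) h).trans (List.map_id w)
  rw [key]
  refine forall₂_congr fun a _ => ?_
  have hsub : w.toFinset.filter (fun c => c < a) ⊆ Finset.Iio a := by
    intro c hc
    simpa using (Finset.mem_filter.1 hc).2
  have hcard : (Finset.Iio a).card + 1 = (a : ℕ) := by
    have h1 : Finset.Iio a = (Finset.Icc 1 a).erase a := by
      ext c
      simp [lt_iff_le_and_ne, and_comm]
    rw [h1, Finset.card_erase_of_mem (by simp), PNat.card_Icc]
    have := a.pos
    simp only [PNat.one_coe]
    omega
  have hr : rank w a = a ↔ (w.toFinset.filter (fun c => c < a)).card = (Finset.Iio a).card := by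
    rw [← PNat.coe_inj, rank, Nat.succPNat_coe]
    omega
  rw [hr]
  constructor
  · intro h b hb
    have := Finset.eq_of_subset_of_card_le hsub h.ge
    have hb' : b ∈ Finset.Iio a := by simpa using hb
    rw [← this] at hb'
    simpa using (Finset.mem_filter.1 hb').1
  · intro h
    congr 1
    apply Finset.Subset.antisymm hsub
    intro b hb
    have hb' : b < a := by simpa using hb
    simpa using ⟨h b hb', hb'⟩

theorem le_maxLetter {w : List ℕ+} {a : ℕ+} (h : a ∈ w) : (a : ℕ) ≤ maxLetter w :=
  Finset.le_sup (f := fun a : ℕ+ => (a : ℕ)) (List.mem_toFinset.2 h)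

theorem mem_of_le_maxLetter {w : List ℕ+} (hw : pack w = w) {b : ℕ+}
    (h : (b : ℕ) ≤ maxLetter w) : b ∈ w := by
  rw [packed_iff] at hw
  obtain ⟨a, ha, hba⟩ : ∃ a ∈ w.toFinset, (b : ℕ) ≤ (a : ℕ) :=
    (Finset.le_sup_iff (a := (b : ℕ)) (by simp)).1 h
  rw [List.mem_toFinset] at ha
  rcases (PNat.coe_le_coe _ _ |>.1 hba).lt_or_eq with h | rfl
  · exact hw a ha b h
  · exact ha

theorem mem_shift {w : List ℕ+} {k : ℕ} {b : ℕ+} :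
    b ∈ shift w k ↔ ∃ a ∈ w, (a : ℕ) + k = b := by
  rw [shift, List.mem_map]
  exact exists_congr fun a => and_congr_right fun _ => PNat.coe_inj.symm

theorem mem_or_mem_shift {u v : List ℕ+} (hu : pack u = u) (hv : pack v = v) {a b : ℕ+}
    (ha : a ∈ u ∨ a ∈ shift v (maxLetter u)) (hab : b < a) :
    b ∈ u ∨ b ∈ shift v (maxLetter u) := by
  by_cases hb : (b : ℕ) ≤ maxLetter u
  · exact Or.inl (mem_of_le_maxLetter hu hb)
  have hab' : (b : ℕ) < a := hab
  rcases ha with ha | ha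
  · have := le_maxLetter ha
    omega
  · obtain ⟨c, hc, hca⟩ := mem_shift.1 ha
    refine Or.inr (mem_shift.2 ⟨(⟨(b : ℕ) - maxLetter u, by omega⟩ : ℕ+), ?_, ?_⟩)
    · refine (packed_iff v).1 hv c hc _ ?_
      refine PNat.coe_lt_coe _ _ |>.1 ?_
      rw [PNat.mk_coe]
      omega
    · rw [PNat.mk_coe]
      omega

/-- Packed words: words `u` with `pack u = u`. -/
@[ext] structure PackedWord where
  /-- The underlying word. -/
  word : List ℕ+
  packed : pack word = word

/-- The packed word `u · v[max u]`. -/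
def PackedWord.catShiftRight (u v : PackedWord) : PackedWord :=
  ⟨u.word ++ shift v.word (maxLetter u.word), by
    rw [packed_iff]
    intro a ha b hb
    rw [List.mem_append] at ha ⊢
    exact mem_or_mem_shift u.packed v.packed ha hb⟩

/-- The packed word `u[max v] · v`. -/
def PackedWord.catShiftLeft (u v : PackedWord) : PackedWord :=
  ⟨shift u.word (maxLetter v.word) ++ v.word, by
    rw [packed_iff]
    intro a ha b hb
    rw [List.mem_append, or_comm] at ha ⊢
    exact mem_or_mem_shift v.packed u.packed ha hb⟩

/-! ### The pseudo-permutohedron -/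

/-- The value of the inversion `(i, j)`, `i < j`, of a word, seen as an ordered set partition of
its positions (position `i` lies in the block whose number is the `i`-th letter): it is `1` if `i`
is in a block strictly to the right of the block of `j`, `1/2` if they are in the same block, and
`0` otherwise. -/
def inversion (w : List ℕ+) (i j : Fin w.length) : ℚ :=
  if w.get j < w.get i then 1 else if w.get i = w.get j then 1 / 2 else 0

/-- The order of the pseudo-permutohedron: packed words of the same length are compared through
their tables of inversions; words of different lengths are not comparable. -/
instance : LE PackedWord where
  le u v := ∃ h : u.word.length = v.word.length, ∀ i j : Fin u.word.length, i < j →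
    inversion u.word i j ≤ inversion v.word (i.cast h) (j.cast h)

theorem le_length {u : List ℕ+} (hu : pack u = u) {a : ℕ+} (ha : a ∈ u) :
    (a : ℕ) ≤ u.length := by
  have h : a ∈ u.map (rank u) := by
    have h2 : pack u = u.map (rank u) := rfl
    rw [← h2, hu]
    exact ha
  obtain ⟨b, hb, rfl⟩ := List.mem_map.1 h
  rw [rank, Nat.succPNat_coe, Nat.succ_le_iff]
  refine lt_of_lt_of_le (Finset.card_lt_card ?_) (List.toFinset_card_le u)
  rw [Finset.ssubset_iff_of_subset (Finset.filter_subset _ _)]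
  exact ⟨b, by simpa using hb, by simp⟩

theorem finite_length_le (n : ℕ) : {u : PackedWord | u.word.length ≤ n}.Finite := by
  have h1 : (Set.Iic (Nat.succPNat n)).Finite := Set.finite_Iic _
  have : Finite (Set.Iic (Nat.succPNat n)) := h1
  have h2 := (List.finite_length_le (Set.Iic (Nat.succPNat n)) n).image
    (List.map (Subtype.val))
  refine Set.Finite.of_finite_image (f := PackedWord.word) (h2.subset ?_)
    (fun _ _ _ _ h => PackedWord.ext h)
  rintro _ ⟨u, hu, rfl⟩
  have hu' : u.word.length ≤ n := hu
  have hm : ∀ a ∈ u.word, a ∈ Set.Iic (Nat.succPNat n) := by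
    intro a ha
    have := le_length u.packed ha
    rw [Set.mem_Iic, ← PNat.coe_le_coe, Nat.succPNat_coe]
    omega
  refine ⟨u.word.attachWith _ hm, by simpa using hu', by simp⟩

theorem finite_below (u : PackedWord) : {v : PackedWord | v ≤ u}.Finite :=
  (finite_length_le u.word.length).subset fun _ ⟨h, _⟩ => h.le

theorem finite_above (u : PackedWord) : {v : PackedWord | u ≤ v}.Finite :=
  (finite_length_le u.word.length).subset fun _ ⟨h, _⟩ => h.ge

/-! ### Noncommutative series -/

/-- Formal series in the noncommuting variables `a₁, a₂, ...` with coefficients in `K`: the series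
`∑ f(w) w` is given by its coefficients `f(w)`, `w` a word. -/
@[ext] structure NCSeries (K : Type*) where
  /-- The coefficient of a word. -/
  coeff : List ℕ+ → K

variable (K : Type*) [CommRing K]

/-- A series is determined by its coefficients. -/
def NCSeries.equivFun : NCSeries K ≃ (List ℕ+ → K) where
  toFun f := f.coeff
  invFun f := ⟨f⟩

instance : AddCommGroup (NCSeries K) := (NCSeries.equivFun K).addCommGroup
instance : Module K (NCSeries K) := (NCSeries.equivFun K).module K

variable {K}

@[simp] theorem NCSeries.coeff_add (f g : NCSeries K) (w : List ℕ+) :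
    (f + g).coeff w = f.coeff w + g.coeff w := rfl
@[simp] theorem NCSeries.coeff_zero (w : List ℕ+) : (0 : NCSeries K).coeff w = 0 := rfl
@[simp] theorem NCSeries.coeff_smul (c : K) (f : NCSeries K) (w : List ℕ+) :
    (c • f).coeff w = c * f.coeff w := rfl

/-- The concatenation product: the coefficient of `w` in `f g` is the sum of `f(x) g(y)` over all
factorizations `w = x · y`. -/
instance : Mul (NCSeries K) where
  mul f g := ⟨fun w => ∑ i ∈ Finset.range (w.length + 1), f.coeff (w.take i) * g.coeff (w.drop i)⟩

instance : One (NCSeries K) where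
  one := ⟨fun w => if w = [] then 1 else 0⟩

theorem NCSeries.coeff_mul (f g : NCSeries K) (w : List ℕ+) :
    (f * g).coeff w = ∑ i ∈ Finset.range (w.length + 1), f.coeff (w.take i) * g.coeff (w.drop i) := rfl

theorem NCSeries.coeff_one (w : List ℕ+) :
    (1 : NCSeries K).coeff w = if w = [] then 1 else 0 := rfl

theorem NCSeries.mul_assoc' (f g h : NCSeries K) : f * g * h = f * (g * h) := by
  ext w
  simp only [NCSeries.coeff_mul, Finset.sum_mul, Finset.mul_sum]
  rw [Finset.sum_sigma', Finset.sum_sigma']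
  refine Finset.sum_bij' (fun p _ => ⟨p.2, p.1 - p.2⟩) (fun p _ => ⟨p.1 + p.2, p.1⟩) ?_ ?_ ?_ ?_ ?_
  · rintro ⟨i, j⟩ hp
    simp only [Finset.mem_sigma, Finset.mem_range, List.length_take, List.length_drop] at hp ⊢
    omega
  · rintro ⟨i, j⟩ hp
    simp only [Finset.mem_sigma, Finset.mem_range, List.length_take, List.length_drop] at hp ⊢
    omega
  · rintro ⟨i, j⟩ hp
    simp only [Finset.mem_sigma, Finset.mem_range, List.length_take] at hp
    have : j + (i - j) = i := by omega
    simp [this]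
  · rintro ⟨i, j⟩ hp
    simp
  · rintro ⟨i, j⟩ hp
    simp only [Finset.mem_sigma, Finset.mem_range, List.length_take] at hp
    have h1 : j + (i - j) = i := by omega
    have h2 : min j i = j := by omega
    simp only [List.take_take, List.drop_take, List.drop_drop, h1, h2, mul_assoc]

theorem NCSeries.one_mul' (f : NCSeries K) : 1 * f = f := by
  ext w
  rw [NCSeries.coeff_mul, Finset.sum_eq_single 0]
  · simp [NCSeries.coeff_one]
  · intro i hi hi0
    have : w.take i ≠ [] := by
      intro h
      have := congrArg List.length h
      simp only [Finset.mem_range, List.length_take, List.length_nil] at hi this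
      rcases List.take_eq_nil_iff.1 h with h | h
      · exact hi0 h
      · subst h
        simp at hi
        exact hi0 hi
    simp [NCSeries.coeff_one, this]
  · simp

theorem NCSeries.mul_one' (f : NCSeries K) : f * 1 = f := by
  ext w
  rw [NCSeries.coeff_mul, Finset.sum_eq_single w.length]
  · simp [NCSeries.coeff_one]
  · intro i hi hi0
    have : w.drop i ≠ [] := by
      rw [Ne, List.drop_eq_nil_iff]
      simp only [Finset.mem_range] at hi
      omega
    simp [NCSeries.coeff_one, this]
  · simp

instance : Ring (NCSeries K) :=
  { (inferInstance : AddCommGroup (NCSeries K)) with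
    mul := (· * ·)
    one := 1
    mul_assoc := NCSeries.mul_assoc'
    one_mul := NCSeries.one_mul'
    mul_one := NCSeries.mul_one'
    left_distrib := fun f g h => by
      ext w
      simp [NCSeries.coeff_mul, mul_add, Finset.sum_add_distrib]
    right_distrib := fun f g h => by
      ext w
      simp [NCSeries.coeff_mul, add_mul, Finset.sum_add_distrib]
    zero_mul := fun f => by
      ext w
      simp [NCSeries.coeff_mul]
    mul_zero := fun f => by
      ext w
      simp [NCSeries.coeff_mul] }

instance : Algebra K (NCSeries K) :=
  Algebra.ofModule
    (fun c f g => by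
      ext w
      simp [NCSeries.coeff_mul, Finset.mul_sum, mul_assoc])
    (fun c f g => by
      ext w
      simp [NCSeries.coeff_mul, Finset.mul_sum, mul_left_comm])

/-! ### The algebra `WQSym` -/

variable (K) in
/-- The series `M_u`, the sum of all words `w` with `pack w = u`. -/
def monomialSeries (u : PackedWord) : NCSeries K := ⟨fun w => if pack w = u.word then 1 else 0⟩

theorem NCSeries.coeff_sum {ι : Type*} (s : Finset ι) (f : ι → NCSeries K) (w : List ℕ+) :
    (∑ i ∈ s, f i).coeff w = ∑ i ∈ s, (f i).coeff w := by
  classical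
  induction s using Finset.induction_on with
  | empty => simp
  | insert a s ha ih => simp [Finset.sum_insert ha, ih]

/-- The span of the `M_u` consists of the series of bounded degree whose coefficients only depend
on the packed word. -/
theorem mem_span_monomialSeries (f : NCSeries K) :
    f ∈ Submodule.span K (Set.range (monomialSeries K)) ↔
      (∀ w, f.coeff w = f.coeff (pack w)) ∧ ∃ n : ℕ, ∀ w : List ℕ+, n < w.length → f.coeff w = 0 := by
  constructor
  · intro hf
    induction hf using Submodule.span_induction with
    | mem x hx =>
      obtain ⟨u, rfl⟩ := hx
      refine ⟨fun w => by simp [monomialSeries, pack_pack], u.word.length, fun w hw => ?_⟩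
      refine if_neg fun h => ?_
      rw [← h, length_pack] at hw
      exact lt_irrefl _ hw
    | zero => exact ⟨fun _ => rfl, 0, fun _ _ => rfl⟩
    | add x y _ _ hx hy =>
      obtain ⟨hx, n, hn⟩ := hx
      obtain ⟨hy, m, hm⟩ := hy
      refine ⟨fun w => ?_, max n m, fun w hw => ?_⟩
      · rw [NCSeries.coeff_add, NCSeries.coeff_add, ← hx, ← hy]
      · rw [NCSeries.coeff_add, hn w (by omega), hm w (by omega), add_zero]
    | smul c x _ hx =>
      obtain ⟨hx, n, hn⟩ := hx
      refine ⟨fun w => ?_, n, fun w hw => ?_⟩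
      · rw [NCSeries.coeff_smul, NCSeries.coeff_smul, ← hx]
      · rw [NCSeries.coeff_smul, hn w hw, mul_zero]
  · rintro ⟨hf, n, hn⟩
    have : f = ∑ u ∈ (finite_length_le n).toFinset, f.coeff u.word • monomialSeries K u := by
      ext w
      rw [NCSeries.coeff_sum, Finset.sum_eq_single (⟨pack w, pack_pack w⟩ : PackedWord)]
      · simp [monomialSeries, ← hf]
      · intro u _ hu
        have : pack w ≠ u.word := fun h => hu (PackedWord.ext h.symm)
        simp [monomialSeries, this]
      · intro h
        have h' : n < w.length := by simpa [length_pack] using h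
        simp [← hf, hn w h']
    rw [this]
    exact Submodule.sum_mem _ fun u _ =>
      Submodule.smul_mem _ _ (Submodule.subset_span ⟨u, rfl⟩)

variable (K) in
/-- The algebra `WQSym` of word quasi-symmetric functions: the span of the series `M_u`, which is
closed under the concatenation product. -/
def WQSym : Subalgebra K (NCSeries K) :=
  (Submodule.span K (Set.range (monomialSeries K))).toSubalgebra
    (by
      rw [mem_span_monomialSeries]
      refine ⟨fun w => ?_, 0, fun w hw => ?_⟩
      · simp [NCSeries.coeff_one, pack]
      · rw [NCSeries.coeff_one, if_neg (List.ne_nil_of_length_pos hw)])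
    (by
      intro f g hf hg
      rw [mem_span_monomialSeries] at hf hg ⊢
      obtain ⟨hf, n, hn⟩ := hf
      obtain ⟨hg, m, hm⟩ := hg
      refine ⟨fun w => ?_, n + m, fun w hw => ?_⟩
      · rw [NCSeries.coeff_mul, NCSeries.coeff_mul, length_pack]
        refine Finset.sum_congr rfl fun i _ => ?_
        rw [hf (w.take i), hg (w.drop i), hf ((pack w).take i), hg ((pack w).drop i),
          pack_take, pack_drop]
      · rw [NCSeries.coeff_mul]
        refine Finset.sum_eq_zero fun i hi => ?_
        rw [Finset.mem_range] at hi
        by_cases h : n < i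
        · rw [hn _ (by rw [List.length_take]; omega), zero_mul]
        · rw [hm _ (by rw [List.length_drop]; omega), mul_zero])

variable (K)

/-- The projective limit of the free associative algebras `K⟨B⟩`, for `B` a finite subset of the
alphabet: a series belongs to it when its restriction to the words over each finite `B` is a
polynomial. -/
def IsNCPoly (f : NCSeries K) : Prop :=
  ∀ B : Finset ℕ+, {w : List ℕ+ | (∀ a ∈ w, a ∈ B) ∧ f.coeff w ≠ 0}.Finite

theorem isNCPoly_of_mem_WQSym {f : NCSeries K} (hf : f ∈ WQSym K) : IsNCPoly K f := by
  obtain ⟨_, n, hn⟩ := (mem_span_monomialSeries f).1 hf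
  intro B
  refine ((List.finite_length_le B n).image (List.map (Subtype.val))).subset ?_
  rintro w ⟨hw, hfw⟩
  have hle : w.length ≤ n := not_lt.1 fun h => hfw (hn w h)
  exact ⟨w.attachWith _ hw, by simpa using hle, by simp⟩

/-- The element `M_u` of `WQSym`. -/
def M (u : PackedWord) : WQSym K := ⟨monomialSeries K u, Submodule.subset_span ⟨u, rfl⟩⟩

/-- `S_u`, the sum of the `M_v` over `v ≤ u` in the pseudo-permutohedron. -/
def S (u : PackedWord) : WQSym K := ∑ v ∈ (finite_below u).toFinset, M K v

/-- `E_u`, the sum of the `M_v` over `v ≥ u` in the pseudo-permutohedron. -/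
def E (u : PackedWord) : WQSym K := ∑ v ∈ (finite_above u).toFinset, M K v

end WQ

end

/-! The `M_u` form a basis, and `S_u` is `M_u` plus terms strictly below `u`. Lower and upper sets
of the pseudo-permutohedron are finite, so unitriangularity makes `(S_u)` a basis, and the opposite
order does the same for `(E_u)`.

For the products, inversion tables depend only on comparisons of letters, which packing preserves.
Hence `S_u` is the indicator series of all words, packed or not, whose table lies below that of `u`
(`coeff_S`), and dually for `E_u` (`coeff_E`). These words have the length of `u`, so in a product
only one cut of each word contributes (`coeff_mul_indicator`), and the conditions apply to prefix
and suffix separately. Shifting the left factor gives every inversion between the factors the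
maximal value 1, and shifting the right one gives 0. Either way the pairs across the cut impose no
condition (`invLE_append`), so the two conditions amount to a single comparison with the
concatenated word. -/

/-! ### Unitriangular change of basis over a partial order -/

open Classical in
/-- If `b` is a basis indexed by a partial order with finite lower sets, then the sums of `b` over
principal lower sets form a basis. -/
theorem Module.Basis.exists_basis_sum_le {P R V : Type*} [PartialOrder P] [Ring R]
    [AddCommGroup V] [Module R V] (b : Module.Basis P R V) (s : P → Finset P)
    (hs : ∀ u v, v ∈ s u ↔ v ≤ u) (f : P → V) (hf : ∀ u, f u = ∑ v ∈ s u, b v) :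
    ∃ b' : Module.Basis P R V, ∀ u, b' u = f u := by
  have hli : LinearIndependent R f := by
    rw [linearIndependent_iff]
    intro l hl
    by_contra hne
    obtain ⟨m, hm⟩ := l.support.exists_maximal (Finsupp.support_nonempty_iff.2 hne)
    -- Only indices `u ≥ m` contribute to coordinate `m`, and `m` is maximal in the support.
    have hcoord : b.repr (Finsupp.linearCombination R f l) m = l m := by
      rw [Finsupp.linearCombination_apply, Finsupp.sum, map_sum, Finsupp.finsetSum_apply,
        Finset.sum_eq_single m]
      · simp [hf, Finsupp.single_apply, hs]
      · intro u hu hum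
        have : ¬ m ≤ u := fun h => hum (le_antisymm (hm.2 hu h) h)
        simp [hf, Finsupp.single_apply, hs, this]
      · exact fun h => absurd hm.1 h
    rw [hl] at hcoord
    exact Finsupp.mem_support_iff.1 hm.1 (by simpa using hcoord.symm)
  -- Induction on the size of the lower set: for `v < u` it is strictly smaller, since it omits `u`.
  have hmem : ∀ n u, (s u).card = n → b u ∈ Submodule.span R (Set.range f) := by
    intro n
    induction n using Nat.strong_induction_on with
    | _ n ih =>
      intro u hu
      have h1 : b u = f u - ∑ v ∈ (s u).erase u, b v := by
        rw [hf, ← Finset.add_sum_erase _ _ ((hs u u).2 le_rfl), add_sub_cancel_right]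
      rw [h1]
      refine sub_mem (Submodule.subset_span ⟨u, rfl⟩) (Submodule.sum_mem _ fun v hv => ?_)
      rw [Finset.mem_erase, hs] at hv
      refine ih _ ?_ v rfl
      rw [← hu]
      refine Finset.card_lt_card ((Finset.ssubset_iff_of_subset fun w hw => ?_).2 ⟨u, ?_, ?_⟩)
      · exact (hs _ _).2 (((hs _ _).1 hw).trans hv.2)
      · exact (hs _ _).2 le_rfl
      · exact fun h => hv.1 (le_antisymm hv.2 ((hs _ _).1 h))
  have hspan : ⊤ ≤ Submodule.span R (Set.range f) := by
    rw [← b.span_eq, Submodule.span_le]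
    rintro _ ⟨u, rfl⟩
    exact hmem _ u rfl
  exact ⟨Module.Basis.mk hli hspan, fun u => by simp⟩

namespace WQ

/-! ### Comparison of inversion tables -/

/-- The comparison of inversion tables, for arbitrary words. -/
def InvLE (u v : List ℕ+) : Prop :=
  u.length = v.length ∧ ∀ (i j : ℕ) (_ : i < j) (_ : j < u.length) (_ : j < v.length),
    (u[j] < u[i] → v[j] < v[i]) ∧ (u[j] ≤ u[i] → v[j] ≤ v[i])

/-- The values are 0, 1/2, 1, so an inequality between two of them is tested at the thresholds 1
(strict descent) and 1/2 (weak descent). -/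
theorem inversion_le_inversion_iff {u v : List ℕ+} (i j : Fin u.length) (k l : Fin v.length) :
    inversion u i j ≤ inversion v k l ↔
      (u.get j < u.get i → v.get l < v.get k) ∧ (u.get j ≤ u.get i → v.get l ≤ v.get k) := by
  unfold inversion
  generalize u.get i = a, u.get j = b, v.get k = c, v.get l = d
  rcases lt_trichotomy b a with h | rfl | h <;> rcases lt_trichotomy d c with h' | rfl | h' <;>
    norm_num [*, le_of_lt, not_lt_of_gt, ne_of_lt, ne_of_gt]

theorem PackedWord.le_iff {u v : PackedWord} : u ≤ v ↔ InvLE u.word v.word := by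
  constructor
  · rintro ⟨h, H⟩
    refine ⟨h, fun i j hij hu hv => ?_⟩
    exact (inversion_le_inversion_iff _ _ _ _).1 (H ⟨i, hij.trans hu⟩ ⟨j, hu⟩ hij)
  · rintro ⟨h, H⟩
    refine ⟨h, fun i j hij => (inversion_le_inversion_iff _ _ _ _).2 ?_⟩
    exact H i j hij j.2 (h ▸ j.2)

/-- Serves both for packing (`rank`) and for shifting letters. -/
theorem invLE_map_left {u v : List ℕ+} {f : ℕ+ → ℕ+} (hf : StrictMonoOn f {a | a ∈ u}) :
    InvLE (u.map f) v ↔ InvLE u v := by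
  have hlt : ∀ i j (hi : i < u.length) (hj : j < u.length), f u[j] < f u[i] ↔ u[j] < u[i] :=
    fun i j hi hj => hf.lt_iff_lt (List.getElem_mem hj) (List.getElem_mem hi)
  have hle : ∀ i j (hi : i < u.length) (hj : j < u.length), f u[j] ≤ f u[i] ↔ u[j] ≤ u[i] :=
    fun i j hi hj => hf.le_iff_le (List.getElem_mem hj) (List.getElem_mem hi)
  simp only [InvLE, List.length_map, List.getElem_map]
  grind

theorem invLE_map_right {u v : List ℕ+} {f : ℕ+ → ℕ+} (hf : StrictMonoOn f {a | a ∈ v}) :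
    InvLE u (v.map f) ↔ InvLE u v := by
  have hlt : ∀ i j (hi : i < v.length) (hj : j < v.length), f v[j] < f v[i] ↔ v[j] < v[i] :=
    fun i j hi hj => hf.lt_iff_lt (List.getElem_mem hj) (List.getElem_mem hi)
  have hle : ∀ i j (hi : i < v.length) (hj : j < v.length), f v[j] ≤ f v[i] ↔ v[j] ≤ v[i] :=
    fun i j hi hj => hf.le_iff_le (List.getElem_mem hj) (List.getElem_mem hi)
  simp only [InvLE, List.length_map, List.getElem_map]
  grind

theorem shiftLetter_strictMono (k : ℕ) : StrictMono (shiftLetter k) := fun a b h => by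
  rw [← PNat.coe_lt_coe, shiftLetter_coe, shiftLetter_coe]
  exact Nat.add_lt_add_right h k

/-- Under `h`, cross pairs are free: either their value on the right is already 1, or their value on
the left is 0. -/
theorem invLE_append {x y u v : List ℕ+} (hx : x.length = u.length) (hy : y.length = v.length)
    (h : (∀ a ∈ u, ∀ b ∈ v, b < a) ∨ (∀ a ∈ x, ∀ b ∈ y, a < b)) :
    InvLE (x ++ y) (u ++ v) ↔ InvLE x u ∧ InvLE y v := by
  constructor
  · rintro ⟨-, H⟩
    refine ⟨⟨hx, fun i j hij h1 h2 => ?_⟩, ⟨hy, fun i j hij h1 h2 => ?_⟩⟩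
    · have := H i j hij (by rw [List.length_append]; omega) (by rw [List.length_append]; omega)
      rwa [List.getElem_append_left h1, List.getElem_append_left h2,
        List.getElem_append_left (hij.trans h1), List.getElem_append_left (hij.trans h2)] at this
    · have := H (u.length + i) (u.length + j) (by omega) (by rw [List.length_append]; omega)
        (by rw [List.length_append]; omega)
      rw [List.getElem_append_right (by omega), List.getElem_append_right (by omega),
        List.getElem_append_right (by omega), List.getElem_append_right (by omega)] at this
      simpa only [hx, Nat.add_sub_cancel_left] using this
  · rintro ⟨⟨-, H1⟩, ⟨-, H2⟩⟩
    refine ⟨by simp [hx, hy], fun i j hij h1 h2 => ?_⟩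
    rw [List.length_append] at h1 h2
    by_cases hj : j < u.length
    · simpa [List.getElem_append, hx, hj, hij.trans hj] using
        H1 i j hij (by omega) (by omega)
    by_cases hi : i < u.length
    · simp only [List.getElem_append, hx, hi, hj, dif_pos, dif_neg, not_false_eq_true]
      rcases h with h | h
      · have := h u[i] (List.getElem_mem _) v[j - u.length] (List.getElem_mem _)
        exact ⟨fun _ => this, fun _ => this.le⟩
      · have := h x[i] (List.getElem_mem _) y[j - u.length] (List.getElem_mem _)
        exact ⟨fun h' => absurd h' this.not_gt, fun h' => absurd h' this.not_ge⟩
    · simpa [List.getElem_append, hx, hi, hj] using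
        H2 (i - u.length) (j - u.length) (by omega) (by omega) (by omega)

/-- Words with the same comparisons of letters differ by a letter map strictly increasing on the
letters of `u`, and `pack_map` applies. -/
theorem pack_eq_pack {u v : List ℕ+} (hl : u.length = v.length)
    (h : ∀ (i j : ℕ) (_ : i < u.length) (_ : j < u.length) (_ : i < v.length) (_ : j < v.length),
      u[i] < u[j] ↔ v[i] < v[j]) : pack u = pack v := by
  have heq : ∀ (i j : ℕ) (_ : i < u.length) (_ : j < u.length) (_ : i < v.length)
      (_ : j < v.length), u[i] = u[j] → v[i] = v[j] := by
    intro i j hi hj hi' hj' e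
    refine le_antisymm (not_lt.1 fun H => ?_) (not_lt.1 fun H => ?_)
    · exact ((h j i hj hi hj' hi').2 H).ne' e
    · exact ((h i j hi hj hi' hj').2 H).ne e
  -- A letter `a` goes to the letter of `v` at the first occurrence of `a` in `u`. The default 1 is
  -- never reached for letters of `u`.
  have hv : v = u.map (fun a => v.getD (u.idxOf a) 1) := by
    refine List.ext_getElem (by simp [hl]) fun i h1 h2 => ?_
    have h2' : i < u.length := hl ▸ h1
    have hidx : u.idxOf u[i] < u.length := List.idxOf_lt_length_iff.2 (List.getElem_mem h2')
    rw [List.getElem_map, List.getD_eq_getElem _ _ (hl ▸ hidx)]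
    exact heq _ _ h2' hidx h1 (hl ▸ hidx) (List.getElem_idxOf hidx).symm
  conv_rhs => rw [hv]
  refine (pack_map _ _ fun a ha b hb hab => ?_).symm
  have ha' := List.idxOf_lt_length_iff.2 ha
  have hb' := List.idxOf_lt_length_iff.2 hb
  rw [List.getD_eq_getElem _ _ (hl ▸ ha'), List.getD_eq_getElem _ _ (hl ▸ hb'),
    ← h _ _ ha' hb' (hl ▸ ha') (hl ▸ hb'), List.getElem_idxOf, List.getElem_idxOf]
  exact hab

/-- The pseudo-permutohedron is a partial order. -/
instance : PartialOrder PackedWord where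
  le u v := u ≤ v
  le_refl u := PackedWord.le_iff.2 ⟨rfl, fun _ _ _ _ _ => ⟨id, id⟩⟩
  le_trans u v w huv hvw := by
    rw [PackedWord.le_iff] at *
    refine ⟨huv.1.trans hvw.1, fun i j hij h1 h2 => ?_⟩
    have h3 := huv.1 ▸ h1
    exact ⟨(hvw.2 i j hij h3 h2).1 ∘ (huv.2 i j hij h1 h3).1,
      (hvw.2 i j hij h3 h2).2 ∘ (huv.2 i j hij h1 h3).2⟩
  le_antisymm u v huv hvu := by
    rw [PackedWord.le_iff] at huv hvu
    refine PackedWord.ext ?_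
    rw [← u.packed, ← v.packed]
    refine pack_eq_pack huv.1 fun i j hi hj hi' hj' => ?_
    -- Tables record only pairs in increasing position. For `i < j` the comparison is the negation
    -- of a weak descent; for `j < i` it is a strict descent.
    rcases lt_trichotomy i j with h | rfl | h
    · rw [← not_le, ← not_le, not_iff_not]
      exact ⟨(huv.2 i j h hj hj').2, (hvu.2 i j h hj' hj).2⟩
    · simp
    · exact ⟨(huv.2 j i h hi hi').1, (hvu.2 j i h hi' hi).1⟩

/-! ### The basis of the `M_u` and the coefficients of `S_u` and `E_u` -/

theorem linearIndependent_monomialSeries (K : Type*) [CommRing K] :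
    LinearIndependent K (monomialSeries K) := by
  rw [linearIndependent_iff]
  intro l hl
  ext u
  have h := congrArg (fun f => NCSeries.coeff f u.word) hl
  simp only [Finsupp.linearCombination_apply, Finsupp.sum, NCSeries.coeff_sum,
    NCSeries.coeff_smul, NCSeries.coeff_zero, monomialSeries, u.packed] at h
  rw [Finset.sum_eq_single u] at h
  · simpa using h
  · intro v _ hv
    rw [if_neg fun e => hv (PackedWord.ext e.symm), mul_zero]
  · intro hu
    simp [Finsupp.notMem_support_iff.1 hu]

/-- The basis `(M_u)` of `WQSym`. -/
noncomputable def basisM (K : Type*) [CommRing K] : Module.Basis PackedWord K (WQSym K) :=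
  Module.Basis.span (linearIndependent_monomialSeries K)

theorem basisM_apply (K : Type*) [CommRing K] (u : PackedWord) : basisM K u = M K u :=
  Module.Basis.span_apply (linearIndependent_monomialSeries K) u

/-- Each word occurs in exactly one `M_v`, the one indexed by its packed word. -/
theorem coeff_sum_M {K : Type*} [CommRing K] (s : Finset PackedWord) (p : PackedWord → Prop)
    [DecidablePred p] (hs : ∀ v, v ∈ s ↔ p v) (w : List ℕ+) :
    (∑ v ∈ s, M K v : WQSym K).1.coeff w = if p ⟨pack w, pack_pack w⟩ then 1 else 0 := by
  classical
  have h : ∀ v, (M K v).1.coeff w = if (⟨pack w, pack_pack w⟩ : PackedWord) = v then 1 else 0 :=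
    fun v => by simp [M, monomialSeries, PackedWord.ext_iff]
  rw [AddSubmonoidClass.coe_finsetSum, NCSeries.coeff_sum]
  simp only [h, Finset.sum_ite_eq, hs]

open Classical in
theorem coeff_S (K : Type*) [CommRing K] (u : PackedWord) (w : List ℕ+) :
    (S K u).1.coeff w = if InvLE w u.word then 1 else 0 := by
  rw [S, coeff_sum_M _ (· ≤ u) (by simp)]
  simp only [PackedWord.le_iff, pack, invLE_map_left (rank_strictMonoOn w)]

open Classical in
theorem coeff_E (K : Type*) [CommRing K] (u : PackedWord) (w : List ℕ+) :
    (E K u).1.coeff w = if InvLE u.word w then 1 else 0 := by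
  rw [E, coeff_sum_M _ (u ≤ ·) (by simp)]
  simp only [PackedWord.le_iff, pack, invLE_map_right (rank_strictMonoOn w)]

open Classical in
/-- The product of the indicator series of two sets of words of fixed lengths. -/
theorem coeff_mul_indicator {K : Type*} [CommRing K] {f g : NCSeries K} {p q : List ℕ+ → Prop}
    (hf : ∀ w, f.coeff w = if p w then 1 else 0) (hg : ∀ w, g.coeff w = if q w then 1 else 0)
    {m : ℕ} (hp : ∀ w, p w → w.length = m) (w : List ℕ+) :
    (f * g).coeff w = if p (w.take m) ∧ q (w.drop m) then 1 else 0 := by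
  rw [NCSeries.coeff_mul]
  simp only [hf, hg]
  -- A cut at `i ≠ m` leaves a prefix of length `i`, which `p` excludes.
  rw [Finset.sum_eq_single m]
  · by_cases h1 : p (w.take m) <;> by_cases h2 : q (w.drop m) <;> simp [h1, h2]
  · intro i hi him
    rw [if_neg, zero_mul]
    intro h
    have := hp _ h
    simp only [List.length_take, Finset.mem_range] at this hi
    omega
  -- Here `m` exceeds the length of `w`, so `w.take m` is too short to satisfy `p`.
  · intro hm
    rw [if_neg, zero_mul]
    intro h
    have := hp _ h
    simp only [List.length_take, Finset.mem_range] at this hm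
    omega

/-! ### Product formulas -/

theorem lt_of_mem_shift {u v : List ℕ+} {a b : ℕ+} (ha : a ∈ shift u (maxLetter v))
    (hb : b ∈ v) : b < a := by
  obtain ⟨c, -, hc⟩ := mem_shift.1 ha
  rw [← PNat.coe_lt_coe]
  have := le_maxLetter hb
  have := c.pos
  omega

theorem invLE_catShiftLeft (u v : PackedWord) (w : List ℕ+) :
    InvLE w (u.catShiftLeft v).word ↔
      InvLE (w.take u.word.length) u.word ∧ InvLE (w.drop u.word.length) v.word := by
  by_cases hw : w.length = u.word.length + v.word.length
  · conv_lhs => rw [← List.take_append_drop u.word.length w]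
    rw [PackedWord.catShiftLeft, invLE_append (by simp [shift, hw]) (by simp [hw])
      (Or.inl fun a ha b hb => lt_of_mem_shift ha hb), shift,
      invLE_map_right ((shiftLetter_strictMono _).strictMonoOn _)]
  -- A word of any other length fails both sides, since each comparison forces equal lengths.
  · refine iff_of_false (fun h => hw ?_) fun h => hw ?_
    · simpa [PackedWord.catShiftLeft, shift] using h.1
    · have h1 := h.1.1
      have h2 := h.2.1
      rw [List.length_take] at h1
      rw [List.length_drop] at h2
      omega

theorem catShiftRight_invLE (u v : PackedWord) (w : List ℕ+) :
    InvLE (u.catShiftRight v).word w ↔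
      InvLE u.word (w.take u.word.length) ∧ InvLE v.word (w.drop u.word.length) := by
  by_cases hw : w.length = u.word.length + v.word.length
  · conv_lhs => rw [← List.take_append_drop u.word.length w]
    rw [PackedWord.catShiftRight, invLE_append (by simp [hw]) (by simp [shift, hw])
      (Or.inr fun a ha b hb => lt_of_mem_shift hb ha), shift,
      invLE_map_left ((shiftLetter_strictMono _).strictMonoOn _)]
  · refine iff_of_false (fun h => hw ?_) fun h => hw ?_
    · simpa [PackedWord.catShiftRight, shift] using h.1.symm
    · have h1 := h.1.1
      have h2 := h.2.1
      rw [List.length_take] at h1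
      rw [List.length_drop] at h2
      omega

open Classical in
theorem S_mul_S (K : Type*) [CommRing K] (u v : PackedWord) :
    S K u * S K v = S K (u.catShiftLeft v) := by
  refine Subtype.ext (NCSeries.ext (funext fun w => ?_))
  refine (coeff_mul_indicator (coeff_S K u) (coeff_S K v) (fun _ h => h.1) w).trans ?_
  rw [coeff_S]
  exact if_congr (invLE_catShiftLeft u v w).symm rfl rfl

open Classical in
theorem E_mul_E (K : Type*) [CommRing K] (u v : PackedWord) :
    E K u * E K v = E K (u.catShiftRight v) := by
  refine Subtype.ext (NCSeries.ext (funext fun w => ?_))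
  refine (coeff_mul_indicator (coeff_E K u) (coeff_E K v) (fun _ h => h.1.symm) w).trans ?_
  rw [coeff_E]
  exact if_congr (catShiftRight_invLE u v w).symm rfl rfl

/-! ### The two bases -/

theorem exists_basis_S (K : Type*) [CommRing K] :
    ∃ b : Module.Basis PackedWord K (WQSym K), ∀ u, b u = S K u :=
  (basisM K).exists_basis_sum_le (fun u => (finite_below u).toFinset) (by simp) _
    fun u => by simp only [S, basisM_apply]

/-- In the dual order the upper sets become lower sets, so the same triangularity argument applies.
-/
theorem exists_basis_E (K : Type*) [CommRing K] :
    ∃ b : Module.Basis PackedWord K (WQSym K), ∀ u, b u = E K u :=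
  Module.Basis.exists_basis_sum_le (P := PackedWordᵒᵈ) (basisM K)
    (fun u => (finite_above (OrderDual.ofDual u)).toFinset)
    (fun _ _ => Set.Finite.mem_toFinset _) _
    fun _ => Finset.sum_congr rfl fun v _ => (basisM_apply K v).symm

end WQ

theorem mainTheorem9 (K : Type*) [Field K] [CharZero K] :
    (∃ b : Module.Basis WQ.PackedWord K (WQ.WQSym K), ∀ u, b u = WQ.S K u) ∧
    (∃ b : Module.Basis WQ.PackedWord K (WQ.WQSym K), ∀ u, b u = WQ.E K u) ∧
    (∀ u' u'' : WQ.PackedWord, WQ.S K u' * WQ.S K u'' = WQ.S K (u'.catShiftLeft u'')) ∧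
    (∀ u' u'' : WQ.PackedWord, WQ.E K u' * WQ.E K u'' = WQ.E K (u'.catShiftRight u'')) :=
  ⟨WQ.exists_basis_S K, WQ.exists_basis_E K, WQ.S_mul_S K, WQ.E_mul_E K⟩
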